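/- Let $K$ be a finite field with $q$ elements, let $W$ be a vector space over $K$ with $\dim_K W > 1$, and let $m = q+1$. A tuple of spaces is an $m$-tuple $\mathcal{V} = (V_1,\dots,V_m)$ of finite-dimensional $K$-subspaces of $W$. Two tuples $\mathcal{U},\mathcal{V}$ are called equivalent if there is a permutation $\pi$ of $\{1,\dots,m\}$ with $V_i = U_{\pi(i)}$ for all $i$. A pair $(\mathcal{U},\mathcal{V})$ is called a solution if $$\sum_{i=1}^m \frac{1}{|V_i|}\mathbf{1}_{V_i} = \sum_{i=1}^m \frac{1}{|U_i|}\mathbf{1}_{U_i}$$ as functions on $W$, where $\mathbf{1}_X$ denotes the indicator function of $X \subseteq W$; a solution is called nontrivial if $\mathcal{U}$ and $\mathcal{V}$ are not equivalent. Then for every tuple of spaces $\mathcal{V}$ there exists, up to equivalence, at most one tuple of spaces $\mathcal{U}$ such that $(\mathcal{U},\mathcal{V})$ is a nontrivial solution; that is, if $(\mathcal{U},\mathcal{V})$ and $(\mathcal{U}',\mathcal{V})$ are both nontrivial solutions, then $\mathcal{U}$ and $\mathcal{U}'$ are equivalent. -/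

import Mathlib

/-- The isometry equation for the pair of tuples of spaces `(U, V)`: the equality of the functions
`∑ i, (1 / |V i|) 𝟙_{V i}` and `∑ i, (1 / |U i|) 𝟙_{U i}` on `W`. -/
def IsSolution {K W : Type*} [Field K] [AddCommGroup W] [Module K W] {m : ℕ}
    (U V : Fin m → Submodule K W) : Prop :=
  ∀ x : W,
    ∑ i, (1 / (Nat.card (V i) : ℝ)) * (V i : Set W).indicator (fun _ => (1 : ℝ)) x =
      ∑ i, (1 / (Nat.card (U i) : ℝ)) * (U i : Set W).indicator (fun _ => (1 : ℝ)) x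

/-- Two tuples of spaces are equivalent if they agree up to a permutation of the entries. -/
def TupleEquiv {K W : Type*} [Field K] [AddCommGroup W] [Module K W] {m : ℕ}
    (U V : Fin m → Submodule K W) : Prop :=
  ∃ π : Equiv.Perm (Fin m), ∀ i, V i = U (π i)

/-- A solution is nontrivial if its two tuples are not equivalent. -/
def IsNontrivialSolution {K W : Type*} [Field K] [AddCommGroup W] [Module K W] {m : ℕ}
    (U V : Fin m → Submodule K W) : Prop :=
  IsSolution U V ∧ ¬ TupleEquiv U V

/-! A space covered by subspaces not containing it needs at least `q + 1` of them, and exactly `q +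
1` form the pencil of hyperplanes through an axis of codimension two, once intersected with it
(`Submodule.finrank_inf_of_cover`). Cancelling common entries of a nontrivial solution leaves a
space of largest dimension covered by the other side, so nothing can have cancelled: the tuples are
disjoint (`IsNontrivialSolution.ne`).

Three pairwise inequivalent solutions are thus pairwise disjoint. If `V j` has the largest dimension
`n` among all entries, `U` and `U'` both cut pencils out of it. Whether all dimensions are `n`, `U`
and `U'` both stay below `n`, or dimensions are mixed, an entry of `U` is forced to equal one of
`U'`, a contradiction. -/

/-! ### Covers by `q + 1` subspaces. -/

theorem Submodule.natCard_eq_pow_finrank {K W : Type*} [Field K] [Finite K] [AddCommGroup W]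
    [Module K W] (S : Submodule K W) [FiniteDimensional K S] :
    Nat.card S = Nat.card K ^ Module.finrank K S :=
  Module.natCard_eq_pow_finrank

open Module in
theorem Submodule.natCard_mul_natCard_le {K W : Type*} [Field K] [Finite K] [AddCommGroup W]
    [Module K W] {S T X : Submodule K W} [FiniteDimensional K X] (hS : S ≤ X) (hT : T ≤ X) :
    Nat.card S * Nat.card T ≤ Nat.card X * Nat.card ↥(S ⊓ T) := by
  have := Submodule.finiteDimensional_of_le hS
  have := Submodule.finiteDimensional_of_le hT
  have h1 := Submodule.finrank_sup_add_finrank_inf_eq S T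
  have h2 := Submodule.finrank_mono (sup_le hS hT)
  simp only [Submodule.natCard_eq_pow_finrank, ← pow_add]
  exact Nat.pow_le_pow_right Nat.card_pos (by omega)

theorem Submodule.natCard_mul_le_of_lt {K W : Type*} [Field K] [Finite K] [AddCommGroup W]
    [Module K W] {S X : Submodule K W} [FiniteDimensional K X] (hS : S < X) :
    Nat.card K * Nat.card S ≤ Nat.card X := by
  have := Submodule.finiteDimensional_of_le hS.le
  have h2 := Submodule.finrank_lt_finrank_of_lt hS
  simp only [Submodule.natCard_eq_pow_finrank, ← pow_succ']
  exact Nat.pow_le_pow_right Nat.card_pos (by omega)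

open Classical in
theorem Submodule.card_filter_mem {K W : Type*} [Field K] [AddCommGroup W]
    [Module K W] {X : Submodule K W} (hX : (X : Set W).Finite) (S : Submodule K W) :
    (hX.toFinset.filter (· ∈ S)).card = Nat.card ↥(S ⊓ X) := by
  rw [← Set.ncard_coe_finset, ← SetLike.coe_sort_coe, Nat.card_coe_set_eq]
  congr 1
  ext x
  simp [and_comm]

open Classical in
/-- If `X` is contained neither in `A` nor in `B`, then `X` has at least `q` times as many
elements outside `A` as `B ⊓ X` has. -/
theorem Submodule.natCard_mul_card_filter_le {K W : Type*} [Field K] [Finite K] [AddCommGroup W]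
    [Module K W] {X A B : Submodule K W} [FiniteDimensional K X] (hX : (X : Set W).Finite)
    (hA : ¬ X ≤ A) (hB : ¬ X ≤ B) :
    0 < (hX.toFinset.filter (· ∉ A)).card ∧
    Nat.card K * ((hX.toFinset.filter (· ∉ A)).filter (· ∈ B)).card ≤
      (hX.toFinset.filter (· ∉ A)).card ∧
    (Nat.card K * ((hX.toFinset.filter (· ∉ A)).filter (· ∈ B)).card =
      (hX.toFinset.filter (· ∉ A)).card →
      Nat.card K * Nat.card ↥(B ⊓ X) = Nat.card X ∧
      Nat.card K * Nat.card ↥(B ⊓ A ⊓ X) = Nat.card ↥(A ⊓ X)) := by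
  have hBX : B ⊓ X < X := inf_lt_right.mpr hB
  have h1 := Submodule.natCard_mul_natCard_le (S := B ⊓ X) (T := A ⊓ X) (X := X)
    inf_le_right inf_le_right
  have h2 := Submodule.natCard_mul_le_of_lt hBX
  have h3 : Nat.card ↥(A ⊓ X) < Nat.card X := by
    have h := Submodule.natCard_mul_le_of_lt (inf_lt_right.mpr hA)
    have : Finite ↥X := hX
    have : Finite ↥(A ⊓ X) := Finite.Set.subset (X : Set W) (fun x hx => hx.2)
    have : 0 < Nat.card ↥(A ⊓ X) := Nat.card_pos
    have := Finite.one_lt_card (α := K)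
    nlinarith
  rw [show (B ⊓ X) ⊓ (A ⊓ X) = B ⊓ A ⊓ X by ac_nf] at h1
  have e1 : (hX.toFinset.filter (· ∉ A)).card + Nat.card ↥(A ⊓ X) = Nat.card X := by
    rw [← Submodule.card_filter_mem hX A, add_comm, Finset.card_filter_add_card_filter_not]
    have := Submodule.card_filter_mem hX ⊤
    simpa using this
  have e2 : ((hX.toFinset.filter (· ∉ A)).filter (· ∈ B)).card + Nat.card ↥(B ⊓ A ⊓ X) =
      Nat.card ↥(B ⊓ X) := by
    rw [← Submodule.card_filter_mem hX (B ⊓ A), ← Submodule.card_filter_mem hX B, add_comm,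
      Finset.filter_filter, ← Finset.card_union_of_disjoint]
    · congr 1
      ext x
      simp only [Finset.mem_union, Finset.mem_filter, Submodule.mem_inf]
      tauto
    · rw [Finset.disjoint_left]
      intro x
      simp only [Finset.mem_filter, Submodule.mem_inf]
      tauto
  generalize (hX.toFinset.filter (· ∉ A)).card = s at *
  generalize ((hX.toFinset.filter (· ∉ A)).filter (· ∈ B)).card = t at *
  generalize Nat.card ↥(A ⊓ X) = a at *
  generalize Nat.card ↥(B ⊓ X) = b at *
  generalize Nat.card ↥(B ⊓ A ⊓ X) = c at *
  generalize Nat.card X = M at *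
  have hq : 0 < Nat.card K := Nat.card_pos
  generalize Nat.card K = q at *
  have hs : 0 < s := by omega
  have hM : 0 < M := by omega
  subst e1 e2
  -- By `h1`, the share of `X \ A` lying in `B` is at most the share of `X` lying in `B`, which is
  -- at most `1 / q`.
  have k1 : (s + a) * (q * t) ≤ q * (t + c) * s := by nlinarith
  have k2 : q * (t + c) * s ≤ (s + a) * s := Nat.mul_le_mul_right _ h2
  refine ⟨hs, Nat.le_of_mul_le_mul_left (k1.trans k2) hM, fun h => ?_⟩
  rw [h] at k1
  have k3 : q * (t + c) = s + a := Nat.eq_of_mul_eq_mul_right hs (le_antisymm k2 k1)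
  refine ⟨k3, ?_⟩
  rw [mul_add] at k3
  omega

-- Outside a fixed `U i`, each other member covers at most `1 / q` of the rest of `X`, so at least
-- `q` others are needed. With exactly `q`, each covers exactly `1 / q` and no two overlap outside
-- `U i`.
open Classical in
theorem Submodule.natCard_lt_card_of_cover {K W ι : Type*} [Field K] [Finite K] [AddCommGroup W]
    [Module K W] {X : Submodule K W} [FiniteDimensional K X] {s : Finset ι}
    {U : ι → Submodule K W} (hU : ∀ i ∈ s, ¬ X ≤ U i) (hc : ∀ x ∈ X, ∃ i ∈ s, x ∈ U i) :
    Nat.card K < s.card ∧ (s.card = Nat.card K + 1 →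
      ∀ i ∈ s, ∀ j ∈ s, i ≠ j →
        Nat.card K * Nat.card ↥(U j ⊓ X) = Nat.card X ∧
        Nat.card K * Nat.card ↥(U j ⊓ U i ⊓ X) = Nat.card ↥(U i ⊓ X) ∧
        ∀ k ∈ s, k ≠ i → j ≠ k → U j ⊓ U k ⊓ X ≤ U i) := by
  have : Finite X := Module.finite_of_finite K
  have hX : (X : Set W).Finite := this
  have main : ∀ i ∈ s, (hX.toFinset.filter (· ∉ U i)).card ≤
        ∑ j ∈ s.erase i, ((hX.toFinset.filter (· ∉ U i)).filter (· ∈ U j)).card ∧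
      ((hX.toFinset.filter (· ∉ U i)).card =
        ∑ j ∈ s.erase i, ((hX.toFinset.filter (· ∉ U i)).filter (· ∈ U j)).card →
        ∀ j ∈ s.erase i, ∀ k ∈ s.erase i, j ≠ k → U j ⊓ U k ⊓ X ≤ U i) := by
    intro i hi
    have e : ∑ j ∈ s.erase i, ((hX.toFinset.filter (· ∉ U i)).filter (· ∈ U j)).card =
        ∑ x ∈ hX.toFinset.filter (· ∉ U i), ((s.erase i).filter (x ∈ U ·)).card := by
      simp only [Finset.card_filter]
      rw [Finset.sum_comm]
    have hle : ∀ x ∈ hX.toFinset.filter (· ∉ U i), 1 ≤ ((s.erase i).filter (x ∈ U ·)).card := by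
      intro x hx
      simp only [Finset.mem_filter, Set.Finite.mem_toFinset, SetLike.mem_coe] at hx
      obtain ⟨j, hj, hxj⟩ := hc x hx.1
      refine Finset.card_pos.mpr ⟨j, ?_⟩
      simp only [Finset.mem_filter, Finset.mem_erase]
      exact ⟨⟨fun h => hx.2 (h ▸ hxj), hj⟩, hxj⟩
    rw [e, Finset.card_eq_sum_ones]
    refine ⟨Finset.sum_le_sum hle, fun h j hj k hk hjk x hx => ?_⟩
    by_contra hxi
    have h1 := (Finset.sum_eq_sum_iff_of_le hle).mp h x (by simpa using ⟨hx.2, hxi⟩)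
    have : 1 < ((s.erase i).filter (x ∈ U ·)).card :=
      Finset.one_lt_card.mpr ⟨j, Finset.mem_filter.mpr ⟨hj, hx.1.1⟩, k,
        Finset.mem_filter.mpr ⟨hk, hx.1.2⟩, hjk⟩
    omega
  have upper : ∀ i ∈ s, Nat.card K *
      ∑ j ∈ s.erase i, ((hX.toFinset.filter (· ∉ U i)).filter (· ∈ U j)).card ≤
      (s.card - 1) * (hX.toFinset.filter (· ∉ U i)).card := by
    intro i hi
    rw [Finset.mul_sum, ← Finset.card_erase_of_mem hi, ← smul_eq_mul (Finset.card _)]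
    refine Finset.sum_le_card_nsmul _ _ _ fun j hj => ?_
    exact (Submodule.natCard_mul_card_filter_le hX (hU i hi)
      (hU j (Finset.mem_of_mem_erase hj))).2.1
  have hq : 0 < Nat.card K := Nat.card_pos
  constructor
  · obtain ⟨i, hi, -⟩ := hc 0 X.zero_mem
    have h1 := (Nat.mul_le_mul_left (Nat.card K) (main i hi).1).trans (upper i hi)
    have h2 := (Submodule.natCard_mul_card_filter_le hX (hU i hi) (hU i hi)).1
    have := Nat.le_of_mul_le_mul_right h1 h2
    omega
  · intro hs i hi
    have h1 := upper i hi
    rw [hs, Nat.add_sub_cancel] at h1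
    have h2 := le_antisymm (main i hi).1 (Nat.le_of_mul_le_mul_left h1 hq)
    have h3 := (main i hi).2 h2
    have h4 : ∀ j ∈ s.erase i, Nat.card K *
        ((hX.toFinset.filter (· ∉ U i)).filter (· ∈ U j)).card =
        (hX.toFinset.filter (· ∉ U i)).card := by
      refine (Finset.sum_eq_sum_iff_of_le fun j hj => ?_).mp ?_
      · exact (Submodule.natCard_mul_card_filter_le hX (hU i hi)
          (hU j (Finset.mem_of_mem_erase hj))).2.1
      · rw [← Finset.mul_sum, ← h2, Finset.sum_const, Finset.card_erase_of_mem hi, hs]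
        simp
    intro j hj hij
    have hj' : j ∈ s.erase i := Finset.mem_erase.mpr ⟨hij.symm, hj⟩
    obtain ⟨h5, h6⟩ := (Submodule.natCard_mul_card_filter_le hX (hU i hi) (hU j hj)).2.2 (h4 j hj')
    exact ⟨h5, h6, fun k hk hki hjk => h3 j hj' k (Finset.mem_erase.mpr ⟨hki, hk⟩) hjk⟩

open Module in
/-- A cover of a space by `q + 1` subspaces not containing it consists of the hyperplanes
through a subspace of codimension two. -/
theorem Submodule.finrank_inf_of_cover {K W : Type*} [Field K] [Finite K] [AddCommGroup W]
    [Module K W] {X : Submodule K W} [FiniteDimensional K X]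
    {U : Fin (Nat.card K + 1) → Submodule K W} (hU : ∀ i, ¬ X ≤ U i)
    (hc : ∀ x ∈ X, ∃ i, x ∈ U i) :
    (∀ i, finrank K ↥(U i ⊓ X) + 1 = finrank K X) ∧
    (∀ i j, i ≠ j → finrank K ↥(U i ⊓ U j ⊓ X) + 2 = finrank K X) ∧
    ∀ i j k, i ≠ j → U i ⊓ U j ⊓ X ≤ U k := by
  have h := (Submodule.natCard_lt_card_of_cover (s := Finset.univ) (fun i _ => hU i)
    (fun x hx => by simpa using hc x hx)).2 (by simp)
  have hq := Finite.one_lt_card (α := K)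
  have h1 : ∀ i, finrank K ↥(U i ⊓ X) + 1 = finrank K X := by
    intro j
    have : Nontrivial (Fin (Nat.card K + 1)) := Fin.nontrivial_iff_two_le.mpr (by omega)
    obtain ⟨i, hij⟩ := exists_ne j
    have h2 := (h i (Finset.mem_univ _) j (Finset.mem_univ _) hij).1
    simp only [Submodule.natCard_eq_pow_finrank, ← pow_succ'] at h2
    exact Nat.pow_right_injective hq h2
  refine ⟨h1, fun j i hij => ?_, fun j k i hjk => ?_⟩
  · have h2 := (h i (Finset.mem_univ _) j (Finset.mem_univ _) hij.symm).2.1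
    simp only [Submodule.natCard_eq_pow_finrank, ← pow_succ'] at h2
    have := Nat.pow_right_injective hq h2
    have := h1 i
    omega
  · by_cases hij : i = j
    · exact hij ▸ inf_le_left.trans inf_le_left
    by_cases hik : i = k
    · exact hik ▸ inf_le_left.trans inf_le_right
    exact (h i (Finset.mem_univ _) j (Finset.mem_univ _) hij).2.2 k (Finset.mem_univ _)
      (Ne.symm hik) hjk

/-! ### Disjointness of nontrivial solutions. -/

theorem Fin.exists_perm_of_map_univ_eq {α : Type*} {m : ℕ} {f g : Fin m → α}
    (h : Multiset.map f Finset.univ.val = Multiset.map g Finset.univ.val) :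
    ∃ π : Equiv.Perm (Fin m), ∀ i, g (π i) = f i := by
  classical
  have e : ∀ c, Nonempty ({a // f a = c} ≃ {b // g b = c}) := by
    intro c
    refine Fintype.card_eq.mp ?_
    have h1 := congrArg (Multiset.count c) h
    rw [Multiset.count_map, Multiset.count_map] at h1
    rw [Fintype.card_subtype, Fintype.card_subtype]
    simpa only [eq_comm, Finset.card_def, Finset.filter_val] using h1
  exact ⟨Equiv.ofFiberEquiv fun c => (e c).some, Equiv.ofFiberEquiv_map _⟩

/-- The value at `x` of the indicator function of `S` divided by the cardinality of `S`. -/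
noncomputable def Submodule.normalizedIndicator {K W : Type*} [Field K] [AddCommGroup W]
    [Module K W] (x : W) (S : Submodule K W) : ℝ :=
  (1 / (Nat.card S : ℝ)) * (S : Set W).indicator (fun _ => (1 : ℝ)) x

theorem Submodule.normalizedIndicator_nonneg {K W : Type*} [Field K] [AddCommGroup W]
    [Module K W] (x : W) (S : Submodule K W) : 0 ≤ S.normalizedIndicator x :=
  mul_nonneg (by positivity) (Set.indicator_nonneg (fun _ _ => zero_le_one) x)

theorem Submodule.normalizedIndicator_pos {K W : Type*} [Field K] [Finite K] [AddCommGroup W]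
    [Module K W] {x : W} {S : Submodule K W} [FiniteDimensional K S] (hx : x ∈ S) :
    0 < S.normalizedIndicator x := by
  have : Finite S := Module.finite_of_finite K
  have h : (0 : ℝ) < Nat.card S := by exact_mod_cast Nat.card_pos
  rw [Submodule.normalizedIndicator, Set.indicator_of_mem hx]
  positivity

theorem Submodule.normalizedIndicator_of_notMem {K W : Type*} [Field K] [AddCommGroup W]
    [Module K W] {x : W} {S : Submodule K W} (hx : x ∉ S) : S.normalizedIndicator x = 0 := by
  rw [Submodule.normalizedIndicator, Set.indicator_of_notMem (by simpa using hx), mul_zero]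

theorem Submodule.exists_mem_of_sum_normalizedIndicator_eq {K W : Type*} [Field K] [Finite K]
    [AddCommGroup W] [Module K W] {A B : Multiset (Submodule K W)} {x : W}
    (h : (A.map (normalizedIndicator x)).sum = (B.map (normalizedIndicator x)).sum)
    {X : Submodule K W} [FiniteDimensional K X] (hX : X ∈ B) (hx : x ∈ X) :
    ∃ S ∈ A, x ∈ S := by
  by_contra! hA
  have h1 : (A.map (normalizedIndicator x)).sum = 0 := by
    refine Multiset.sum_eq_zero fun y hy => ?_
    obtain ⟨S, hS, rfl⟩ := Multiset.mem_map.mp hy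
    exact normalizedIndicator_of_notMem (hA S hS)
  have h2 : normalizedIndicator x X ≤ (B.map (normalizedIndicator x)).sum := by
    refine Multiset.single_le_sum (fun y hy => ?_) _ (Multiset.mem_map_of_mem _ hX)
    obtain ⟨S, hS, rfl⟩ := Multiset.mem_map.mp hy
    exact normalizedIndicator_nonneg x S
  have := normalizedIndicator_pos hx
  linarith

open Module in
theorem Submodule.not_le_of_ne_of_finrank_le {K W : Type*} [Field K] [AddCommGroup W]
    [Module K W] {X S : Submodule K W} [FiniteDimensional K S] (h : S ≠ X)
    (hr : finrank K S ≤ finrank K X) : ¬ X ≤ S :=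
  fun hle => h (Submodule.eq_of_le_of_finrank_le hle hr).symm

-- Since all terms are nonnegative, `A` covers `X`; by maximality no member of `A` contains `X`.
open Module in
theorem Submodule.natCard_lt_card_of_sum_normalizedIndicator_eq {K W : Type*} [Field K] [Finite K]
    [AddCommGroup W] [Module K W] {A B : Multiset (Submodule K W)}
    (h : ∀ x, (A.map (normalizedIndicator x)).sum = (B.map (normalizedIndicator x)).sum)
    (hA : ∀ S ∈ A, FiniteDimensional K S)
    {X : Submodule K W} [FiniteDimensional K X] (hX : X ∈ B) (hXA : X ∉ A)
    (hmax : ∀ S ∈ A, finrank K S ≤ finrank K X) :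
    Nat.card K < A.card := by
  classical
  refine lt_of_lt_of_le (Submodule.natCard_lt_card_of_cover (X := X) (s := A.toFinset) (U := id)
    (fun S hS => ?_) fun x hx => ?_).1 (Multiset.toFinset_card_le A)
  · rw [Multiset.mem_toFinset] at hS
    have := hA S hS
    change ¬ X ≤ S
    exact not_le_of_ne_of_finrank_le (fun h => hXA (h ▸ hS)) (hmax S hS)
  · obtain ⟨S, hS, hxS⟩ := exists_mem_of_sum_normalizedIndicator_eq (h x) hX hx
    exact ⟨S, by simpa using hS, hxS⟩

theorem Multiset.notMem_of_mem_of_sub_eq {α : Type*} [DecidableEq α] {M N : Multiset α}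
    (h : M - N = M) {a : α} (ha : a ∈ M) : a ∉ N := by
  intro hN
  have h1 := congrArg (Multiset.count a) h
  rw [Multiset.count_sub] at h1
  have := Multiset.count_pos.mpr ha
  have := Multiset.count_pos.mpr hN
  omega

open Module in
/-- The two tuples of a nontrivial solution of length `q + 1` have no space in common. -/
theorem IsNontrivialSolution.ne {K W : Type*} [Field K] [Finite K] [AddCommGroup W] [Module K W]
    {U V : Fin (Nat.card K + 1) → Submodule K W}
    (hV : ∀ i, FiniteDimensional K (V i)) (hU : ∀ i, FiniteDimensional K (U i))
    (h : IsNontrivialSolution U V) (i j) : U i ≠ V j := by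
  classical
  obtain ⟨hs, hne⟩ := h
  set M := Multiset.map U Finset.univ.val with hM
  set N := Multiset.map V Finset.univ.val with hN
  have hMc : M.card = Nat.card K + 1 := by simp [hM]
  have hNc : N.card = Nat.card K + 1 := by simp [hN]
  have hMf : ∀ S ∈ M, FiniteDimensional K S := by
    intro S hS
    obtain ⟨i, -, rfl⟩ := Multiset.mem_map.mp hS
    exact hU i
  have hNf : ∀ S ∈ N, FiniteDimensional K S := by
    intro S hS
    obtain ⟨i, -, rfl⟩ := Multiset.mem_map.mp hS
    exact hV i
  have hiM : U i ∈ M := Multiset.mem_map_of_mem _ (Finset.mem_univ i)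
  have hjN : V j ∈ N := Multiset.mem_map_of_mem _ (Finset.mem_univ j)
  have hsum : ∀ x, ((M - N).map (Submodule.normalizedIndicator x)).sum =
      ((N - M).map (Submodule.normalizedIndicator x)).sum := by
    intro x
    have h1 : (M.map (Submodule.normalizedIndicator x)).sum =
        (N.map (Submodule.normalizedIndicator x)).sum := by
      rw [hM, hN, Multiset.map_map, Multiset.map_map]
      exact (hs x).symm
    have h2 := congrArg (fun A => (A.map (Submodule.normalizedIndicator x)).sum)
      (Multiset.sub_add_inter M N)
    have h3 := congrArg (fun A => (A.map (Submodule.normalizedIndicator x)).sum)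
      (Multiset.sub_add_inter N M)
    rw [Multiset.inter_comm N M] at h3
    simp only [Multiset.map_add, Multiset.sum_add] at h2 h3
    linarith
  have hdis : ∀ S, S ∈ M - N → S ∉ N - M := by
    intro S h1 h2
    have h3 := Multiset.count_pos.mpr h1
    have h4 := Multiset.count_pos.mpr h2
    rw [Multiset.count_sub] at h3 h4
    omega
  have hne0 : ((M - N) + (N - M)).toFinset.Nonempty := by
    rw [Multiset.toFinset_nonempty]
    intro h0
    rw [add_eq_zero, tsub_eq_zero_iff_le, tsub_eq_zero_iff_le] at h0
    obtain ⟨π, hπ⟩ := Fin.exists_perm_of_map_univ_eq (le_antisymm h0.2 h0.1)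
    exact hne ⟨π, fun i => (hπ i).symm⟩
  obtain ⟨X, hX, hmax⟩ := Finset.exists_max_image _ (fun S : Submodule K W => finrank K S) hne0
  simp only [Multiset.mem_toFinset, Multiset.mem_add] at hX hmax
  rcases hX with hX | hX
  · have := hMf X (Multiset.mem_of_le tsub_le_self hX)
    have h1 := Submodule.natCard_lt_card_of_sum_normalizedIndicator_eq (fun x => (hsum x).symm)
      (fun S hS => hNf S (Multiset.mem_of_le tsub_le_self hS)) hX (hdis X hX)
      (fun S hS => hmax S (Or.inr hS))
    -- More than `q` of the `q + 1` entries survive, so none was cancelled.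
    have h2 : N - M = N := Multiset.eq_of_le_of_card_le tsub_le_self (by omega)
    exact fun e => Multiset.notMem_of_mem_of_sub_eq h2 hjN (e ▸ hiM)
  · have := hNf X (Multiset.mem_of_le tsub_le_self hX)
    have h1 := Submodule.natCard_lt_card_of_sum_normalizedIndicator_eq hsum
      (fun S hS => hMf S (Multiset.mem_of_le tsub_le_self hS)) hX (fun h => hdis X h hX)
      (fun S hS => hmax S (Or.inl hS))
    have h2 : M - N = M := Multiset.eq_of_le_of_card_le tsub_le_self (by omega)
    exact fun e => Multiset.notMem_of_mem_of_sub_eq h2 hiM (e ▸ hjN)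

/-! ### Pencils and point counts. -/

open Module in
/-- If some space `V j` of a solution has dimension at least that of all spaces `U i`, and is not
among them, then the `U i` cut out of `V j` the hyperplanes through a subspace of codimension
two. -/
theorem IsSolution.finrank_inf {K W : Type*} [Field K] [Finite K] [AddCommGroup W] [Module K W]
    {U V : Fin (Nat.card K + 1) → Submodule K W} [∀ i, FiniteDimensional K (V i)]
    [∀ i, FiniteDimensional K (U i)] (h : IsSolution U V) {j : Fin (Nat.card K + 1)}
    (hne : ∀ i, U i ≠ V j) (hmax : ∀ i, finrank K (U i) ≤ finrank K (V j)) :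
    (∀ i, finrank K ↥(U i ⊓ V j) + 1 = finrank K (V j)) ∧
    (∀ i k, i ≠ k → finrank K ↥(U i ⊓ U k ⊓ V j) + 2 = finrank K (V j)) ∧
    (∀ i k l, i ≠ k → U i ⊓ U k ⊓ V j ≤ U l) ∧
    ∀ x ∈ V j, ∃ i, x ∈ U i := by
  have hc : ∀ x ∈ V j, ∃ i, x ∈ U i := by
    intro x hx
    obtain ⟨S, hS, hxS⟩ := Submodule.exists_mem_of_sum_normalizedIndicator_eq (A := Multiset.map U Finset.univ.val)
      (B := Multiset.map V Finset.univ.val) (x := x)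
      (by rw [Multiset.map_map, Multiset.map_map]; exact (h x).symm)
      (Multiset.mem_map_of_mem _ (Finset.mem_univ j)) hx
    obtain ⟨i, -, rfl⟩ := Multiset.mem_map.mp hS
    exact ⟨i, hxS⟩
  obtain ⟨h1, h2, h3⟩ := Submodule.finrank_inf_of_cover
    (fun i => Submodule.not_le_of_ne_of_finrank_le (hne i) (hmax i)) hc
  exact ⟨h1, h2, h3, hc⟩

-- Multiplying by `q ^ n` gives an identity of natural numbers, open to counting and divisibility
-- arguments.
open Module Classical in
theorem IsSolution.sum_pow_eq {K W : Type*} [Field K] [Finite K] [AddCommGroup W] [Module K W]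
    {m : ℕ} {U V : Fin m → Submodule K W} [∀ i, FiniteDimensional K (V i)]
    [∀ i, FiniteDimensional K (U i)] (h : IsSolution U V) {n : ℕ}
    (hU : ∀ i, finrank K (U i) ≤ n) (hV : ∀ i, finrank K (V i) ≤ n) (x : W) :
    ∑ i, (if x ∈ U i then Nat.card K ^ (n - finrank K (U i)) else 0) =
      ∑ i, if x ∈ V i then Nat.card K ^ (n - finrank K (V i)) else 0 := by
  have hq : (Nat.card K : ℝ) ≠ 0 := by exact_mod_cast (Nat.card_pos (α := K)).ne'
  have key : ∀ S : Submodule K W, FiniteDimensional K S → finrank K S ≤ n →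
      (((if x ∈ S then Nat.card K ^ (n - finrank K S) else 0 : ℕ)) : ℝ) =
        (Nat.card K : ℝ) ^ n * S.normalizedIndicator x := by
    intro S _ hS
    split_ifs with hx
    · rw [Submodule.normalizedIndicator, Set.indicator_of_mem hx,
        Submodule.natCard_eq_pow_finrank, Nat.cast_pow, Nat.cast_pow, pow_sub₀ _ hq hS]
      ring
    · rw [Submodule.normalizedIndicator_of_notMem hx]
      simp
  have := h x
  apply Nat.cast_injective (R := ℝ)
  rw [Nat.cast_sum, Nat.cast_sum, Finset.sum_congr rfl fun i _ => key (U i) inferInstance (hU i),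
    Finset.sum_congr rfl fun i _ => key (V i) inferInstance (hV i), ← Finset.mul_sum,
    ← Finset.mul_sum]
  exact congrArg _ this.symm

theorem IsSolution.symm {K W : Type*} [Field K] [AddCommGroup W] [Module K W] {m : ℕ}
    {U V : Fin m → Submodule K W} (h : IsSolution U V) : IsSolution V U :=
  fun x => (h x).symm

theorem IsSolution.trans {K W : Type*} [Field K] [AddCommGroup W] [Module K W] {m : ℕ}
    {U V T : Fin m → Submodule K W} (h : IsSolution U V) (h' : IsSolution V T) :
    IsSolution U T :=
  fun x => (h' x).trans (h x)

open Module in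
/-- Two tuples of constant dimension forming a solution cover each point equally often. -/
theorem IsSolution.card_filter_eq {K W : Type*} [Field K] [Finite K] [AddCommGroup W] [Module K W]
    {m : ℕ} {U V : Fin m → Submodule K W} [∀ i, FiniteDimensional K (V i)]
    [∀ i, FiniteDimensional K (U i)] (h : IsSolution U V) {n : ℕ}
    (hU : ∀ i, finrank K (U i) = n) (hV : ∀ i, finrank K (V i) = n) (x : W)
    [DecidablePred (x ∈ U ·)] [DecidablePred (x ∈ V ·)] :
    (Finset.univ.filter (x ∈ U ·)).card = (Finset.univ.filter (x ∈ V ·)).card := by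
  classical
  have := h.sum_pow_eq (fun i => (hU i).le) (fun i => (hV i).le) x
  simp only [hU, hV, Nat.sub_self, pow_zero, Finset.sum_boole, Nat.cast_id] at this
  convert this

open Module in
theorem IsSolution.mem_of_forall_mem {K W : Type*} [Field K] [Finite K] [AddCommGroup W]
    [Module K W] {m : ℕ} {U V : Fin m → Submodule K W} [∀ i, FiniteDimensional K (V i)]
    [∀ i, FiniteDimensional K (U i)] (h : IsSolution U V) {n : ℕ}
    (hU : ∀ i, finrank K (U i) = n) (hV : ∀ i, finrank K (V i) = n) {x : W}
    (hx : ∀ i, x ∈ U i) (i : Fin m) : x ∈ V i := by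
  classical
  have := h.card_filter_eq hU hV x
  rw [Finset.filter_true_of_mem fun i _ => hx i] at this
  have h1 := Finset.eq_of_subset_of_card_le (Finset.filter_subset (x ∈ V ·) Finset.univ) this.le
  exact Finset.filter_eq_self.mp h1 i (Finset.mem_univ i)

-- At `x = 0` the `m` terms `q ^ (n - dim U i) ≥ 1` sum to `m`, so each is `1`.
open Module in
theorem IsSolution.finrank_eq_of_forall_finrank_eq {K W : Type*} [Field K] [Finite K]
    [AddCommGroup W] [Module K W] {m : ℕ} {U V : Fin m → Submodule K W}
    [∀ i, FiniteDimensional K (V i)] [∀ i, FiniteDimensional K (U i)] (h : IsSolution U V) {n : ℕ}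
    (hU : ∀ i, finrank K (U i) ≤ n) (hV : ∀ i, finrank K (V i) = n) (i : Fin m) :
    finrank K (U i) = n := by
  have h1 := h.sum_pow_eq hU (fun i => (hV i).le) 0
  simp only [Submodule.zero_mem, if_true, hV, Nat.sub_self, pow_zero] at h1
  have hq := Finite.one_lt_card (α := K)
  have h2 := (Finset.sum_eq_sum_iff_of_le fun i _ =>
    (Nat.one_le_pow (n - finrank K (U i)) _ (by omega : 0 < Nat.card K))).mp h1.symm i
    (Finset.mem_univ i)
  have h3 := (Nat.pow_eq_one.mp h2.symm)
  have := hU i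
  omega

-- By `hle` the two pencils in `V j` have a common axis. A point of `U i ⊓ V j` off the axis
-- determines the hyperplane, and some `U' l` contains that point.
open Module in
theorem IsSolution.exists_inf_eq_inf {K W : Type*} [Field K] [Finite K] [AddCommGroup W]
    [Module K W] {U U' V : Fin (Nat.card K + 1) → Submodule K W}
    [∀ i, FiniteDimensional K (V i)] [∀ i, FiniteDimensional K (U i)]
    [∀ i, FiniteDimensional K (U' i)] (h : IsSolution U V) (h' : IsSolution U' V)
    {j : Fin (Nat.card K + 1)} (hne : ∀ i, U i ≠ V j) (hne' : ∀ i, U' i ≠ V j)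
    (hmax : ∀ i, finrank K (U i) ≤ finrank K (V j))
    (hmax' : ∀ i, finrank K (U' i) ≤ finrank K (V j))
    (hle : ∀ x, (∀ i, x ∈ U i) → x ∈ V j → ∀ i, x ∈ U' i) (i : Fin (Nat.card K + 1)) :
    ∃ l, U i ⊓ V j = U' l ⊓ V j := by
  have hq := Finite.one_lt_card (α := K)
  have : Nontrivial (Fin (Nat.card K + 1)) := Fin.nontrivial_iff_two_le.mpr (by omega)
  obtain ⟨a, b, hab⟩ := exists_pair_ne (Fin (Nat.card K + 1))
  obtain ⟨h1, h2, h3, -⟩ := h.finrank_inf hne hmax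
  obtain ⟨h1', -, -, hc'⟩ := h'.finrank_inf hne' hmax'
  have hY : U a ⊓ U b ⊓ V j < U i ⊓ V j := by
    refine lt_of_le_of_ne (le_inf (h3 a b i hab) inf_le_right) fun e => ?_
    have h4 := h1 i
    have h5 := h2 a b hab
    rw [e] at h5
    omega
  obtain ⟨x, hx, hxY⟩ := SetLike.exists_of_lt hY
  obtain ⟨l, hl⟩ := hc' x hx.2
  refine ⟨l, ?_⟩
  have hY' : U a ⊓ U b ⊓ V j < U i ⊓ U' l ⊓ V j := by
    refine lt_of_le_of_ne (fun y hy => ⟨⟨h3 a b i hab hy, ?_⟩, hy.2⟩) fun e => ?_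
    · exact hle y (fun c => h3 a b c hab hy) hy.2 l
    · exact hxY (e ▸ ⟨⟨hx.1, hl⟩, hx.2⟩)
  have h4 := Submodule.finrank_lt_finrank_of_lt hY'
  have h5 := h2 a b hab
  have e1 : U i ⊓ U' l ⊓ V j = U i ⊓ V j :=
    Submodule.eq_of_le_of_finrank_le (inf_le_inf_right _ inf_le_left)
      (by have := h1 i; omega)
  have e2 : U i ⊓ U' l ⊓ V j = U' l ⊓ V j :=
    Submodule.eq_of_le_of_finrank_le (inf_le_inf_right _ inf_le_right)
      (by have := h1' l; omega)
  exact e1.symm.trans e2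

-- A point of `V j ⊓ V k` is covered twice by `V`, hence twice by `U`, hence lies on the axis of the
-- pencil in `V j`.
open Module in
theorem IsSolution.finrank_inf_add_two_le {K W : Type*} [Field K] [Finite K] [AddCommGroup W]
    [Module K W] {U V : Fin (Nat.card K + 1) → Submodule K W}
    [∀ i, FiniteDimensional K (V i)] [∀ i, FiniteDimensional K (U i)] (h : IsSolution U V)
    (hne : ∀ i j, U i ≠ V j) {n : ℕ} (hU : ∀ i, finrank K (U i) = n)
    (hV : ∀ i, finrank K (V i) = n) {j k : Fin (Nat.card K + 1)} (hjk : j ≠ k) :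
    finrank K ↥(V j ⊓ V k) + 2 ≤ n := by
  classical
  have hq := Finite.one_lt_card (α := K)
  have : Nontrivial (Fin (Nat.card K + 1)) := Fin.nontrivial_iff_two_le.mpr (by omega)
  obtain ⟨a, b, hab⟩ := exists_pair_ne (Fin (Nat.card K + 1))
  obtain ⟨-, h2, h3, -⟩ := h.finrank_inf (j := j) (hne · j) (fun i => by rw [hU, hV])
  have hle : V j ⊓ V k ≤ U a ⊓ U b ⊓ V j := by
    intro x hx
    have h4 : 1 < (Finset.univ.filter (x ∈ V ·)).card :=
      Finset.one_lt_card.mpr ⟨j, by simpa using hx.1, k, by simpa using hx.2, hjk⟩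
    rw [← h.card_filter_eq hU hV x] at h4
    obtain ⟨c, hc, d, hd, hcd⟩ := Finset.one_lt_card.mp h4
    simp only [Finset.mem_filter, Finset.mem_univ, true_and] at hc hd
    exact ⟨⟨h3 c d a hcd ⟨⟨hc, hd⟩, hx.1⟩, h3 c d b hcd ⟨⟨hc, hd⟩, hx.1⟩⟩, hx.1⟩
  have h5 := Submodule.finrank_mono hle
  have h6 := h2 a b hab
  have := hV j
  omega

open Module in
theorem Submodule.le_sup_of_finrank_inf {K W : Type*} [Field K] [AddCommGroup W] [Module K W]
    {A B X : Submodule K W} [FiniteDimensional K A] [FiniteDimensional K B]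
    [FiniteDimensional K X] {n : ℕ} (hX : finrank K X = n)
    (hA : finrank K ↥(A ⊓ X) + 1 = n) (hB : finrank K ↥(B ⊓ X) + 1 = n)
    (hAB : finrank K ↥(A ⊓ B ⊓ X) + 2 ≤ n) : X ≤ A ⊔ B := by
  have h1 := Submodule.finrank_sup_add_finrank_inf_eq (A ⊓ X) (B ⊓ X)
  rw [show (A ⊓ X) ⊓ (B ⊓ X) = A ⊓ B ⊓ X by ac_nf] at h1
  have h2 : (A ⊓ X) ⊔ (B ⊓ X) = X :=
    Submodule.eq_of_le_of_finrank_le (sup_le inf_le_right inf_le_right) (by omega)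
  exact h2 ▸ sup_le_sup inf_le_left inf_le_left

-- If `A ≠ B`, then `A ⊓ B = A ⊓ X` and `A ⊔ B` has dimension `n + 1`. It contains `Y` and `Z`,
-- which would then meet in dimension at least `n - 1`.
open Module in
theorem Submodule.eq_of_inf_eq_inf {K W : Type*} [Field K] [AddCommGroup W] [Module K W]
    {A B X Y Z : Submodule K W} [FiniteDimensional K A] [FiniteDimensional K B]
    [FiniteDimensional K X] [FiniteDimensional K Y] [FiniteDimensional K Z] {n : ℕ}
    (hA : finrank K A = n) (hB : finrank K B = n) (hY : finrank K Y = n) (hZ : finrank K Z = n)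
    (hXY : finrank K ↥(X ⊓ Y) + 2 ≤ n) (hXZ : finrank K ↥(X ⊓ Z) + 2 ≤ n)
    (hYZ : finrank K ↥(Y ⊓ Z) + 2 ≤ n) (hAX : finrank K ↥(A ⊓ X) + 1 = n)
    (hAY : finrank K ↥(A ⊓ Y) + 1 = n) (hBY : finrank K ↥(B ⊓ Y) + 1 = n)
    (hAZ : finrank K ↥(A ⊓ Z) + 1 = n) (hBZ : finrank K ↥(B ⊓ Z) + 1 = n)
    (h : A ⊓ X = B ⊓ X) : A = B := by
  by_contra hAB
  have h1 : A ⊓ B < A := by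
    refine lt_of_le_of_ne inf_le_left fun e => hAB ?_
    exact Submodule.eq_of_le_of_finrank_eq (inf_eq_left.mp e) (hA.trans hB.symm)
  have h2 := Submodule.finrank_lt_finrank_of_lt h1
  have h3 : A ⊓ X = A ⊓ B :=
    Submodule.eq_of_le_of_finrank_le (le_inf inf_le_left (h ▸ inf_le_left)) (by omega)
  have h4 := Submodule.finrank_sup_add_finrank_inf_eq A B
  rw [← h3] at h4
  have hY' : Y ≤ A ⊔ B := Submodule.le_sup_of_finrank_inf hY hAY hBY <| by
    have := Submodule.finrank_mono (show A ⊓ B ⊓ Y ≤ X ⊓ Y from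
      inf_le_inf_right _ (h3 ▸ inf_le_right))
    omega
  have hZ' : Z ≤ A ⊔ B := Submodule.le_sup_of_finrank_inf hZ hAZ hBZ <| by
    have := Submodule.finrank_mono (show A ⊓ B ⊓ Z ≤ X ⊓ Z from
      inf_le_inf_right _ (h3 ▸ inf_le_right))
    omega
  have h5 := Submodule.finrank_sup_add_finrank_inf_eq Y Z
  have h6 := Submodule.finrank_mono (sup_le hY' hZ')
  omega

open Module in
/-- Three tuples of spaces of constant dimension `n` cannot be pairwise disjoint solutions. -/
theorem IsSolution.false_of_forall_finrank_eq {K W : Type*} [Field K] [Finite K] [AddCommGroup W]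
    [Module K W] {U U' V : Fin (Nat.card K + 1) → Submodule K W}
    [∀ i, FiniteDimensional K (V i)] [∀ i, FiniteDimensional K (U i)]
    [∀ i, FiniteDimensional K (U' i)] (h : IsSolution U V) (h' : IsSolution U' V)
    (hne : ∀ i j, U i ≠ V j) (hne' : ∀ i j, U' i ≠ V j) (hUU' : ∀ i j, U i ≠ U' j) {n : ℕ}
    (hU : ∀ i, finrank K (U i) = n) (hU' : ∀ i, finrank K (U' i) = n)
    (hV : ∀ i, finrank K (V i) = n) : False := by
  have hq := Finite.one_lt_card (α := K)
  obtain ⟨a, b, c, hab, hac, hbc⟩ := Fintype.two_lt_card_iff.mp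
    (show 2 < Fintype.card (Fin (Nat.card K + 1)) by rw [Fintype.card_fin]; omega)
  have hm : ∀ i j, finrank K (U i) ≤ finrank K (V j) := fun i j => by rw [hU, hV]
  have hm' : ∀ i j, finrank K (U' i) ≤ finrank K (V j) := fun i j => by rw [hU', hV]
  obtain ⟨l, hl⟩ := h.exists_inf_eq_inf h' (j := a) (hne · a) (hne' · a) (hm · a) (hm' · a)
    (fun x hx _ => (h.trans h'.symm).mem_of_forall_mem hU hU' hx) a
  have h1 : ∀ i j, finrank K ↥(U i ⊓ V j) + 1 = n := fun i j =>
    ((h.finrank_inf (hne · j) (hm · j)).1 i).trans (hV j)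
  have h1' : ∀ i j, finrank K ↥(U' i ⊓ V j) + 1 = n := fun i j =>
    ((h'.finrank_inf (hne' · j) (hm' · j)).1 i).trans (hV j)
  exact hUU' a l (Submodule.eq_of_inf_eq_inf (hU a) (hU' l) (hV b) (hV c)
    (h.finrank_inf_add_two_le hne hU hV hab) (h.finrank_inf_add_two_le hne hU hV hac)
    (h.finrank_inf_add_two_le hne hU hV hbc) (h1 a a) (h1 a b) (h1' l b) (h1 a c) (h1' l c) hl)

/-! ### Mixed dimensions. -/

open Module in
theorem IsSolution.le_of_finrank_ne {K W : Type*} [Field K] [Finite K] [AddCommGroup W]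
    [Module K W] {U V : Fin (Nat.card K + 1) → Submodule K W} [∀ i, FiniteDimensional K (V i)]
    [∀ i, FiniteDimensional K (U i)] (h : IsSolution U V) {j : Fin (Nat.card K + 1)}
    (hne : ∀ i, U i ≠ V j) (hmax : ∀ i, finrank K (U i) ≤ finrank K (V j))
    {i : Fin (Nat.card K + 1)} (hi : finrank K (U i) ≠ finrank K (V j)) :
    U i ≤ V j ∧ finrank K (U i) + 1 = finrank K (V j) := by
  have h1 := (h.finrank_inf hne hmax).1 i
  have h2 := hmax i
  have h3 : U i ⊓ V j = U i := Submodule.eq_of_le_of_finrank_le inf_le_left (by omega)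
  rw [h3] at h1
  exact ⟨inf_eq_left.mp h3, h1⟩

-- At a point of `U i` off the axis, `U i` alone contributes to the `U` side, giving `q`. On the
-- other side `V j` gives `1`; were all other `V k` smaller, the rest would be divisible by `q`.
open Module in
theorem IsSolution.exists_ne_finrank_eq {K W : Type*} [Field K] [Finite K] [AddCommGroup W]
    [Module K W] {U V : Fin (Nat.card K + 1) → Submodule K W} [∀ i, FiniteDimensional K (V i)]
    [∀ i, FiniteDimensional K (U i)] (h : IsSolution U V) {j : Fin (Nat.card K + 1)}
    (hne : ∀ i, U i ≠ V j) (hmax : ∀ i, finrank K (U i) ≤ finrank K (V j))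
    (hmaxV : ∀ i, finrank K (V i) ≤ finrank K (V j))
    {i : Fin (Nat.card K + 1)} (hi : finrank K (U i) ≠ finrank K (V j)) :
    ∃ k, k ≠ j ∧ finrank K (V k) = finrank K (V j) := by
  classical
  by_contra! hk
  have hq := Finite.one_lt_card (α := K)
  have : Nontrivial (Fin (Nat.card K + 1)) := Fin.nontrivial_iff_two_le.mpr (by omega)
  obtain ⟨l, hli⟩ := exists_ne i
  obtain ⟨hle, hr⟩ := h.le_of_finrank_ne hne hmax hi
  obtain ⟨h1, h2, h3, -⟩ := h.finrank_inf hne hmax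
  have hY : U i ⊓ U l ⊓ V j < U i := by
    refine lt_of_le_of_ne (inf_le_left.trans inf_le_left) fun e => ?_
    have := h2 i l hli.symm
    rw [e] at this
    omega
  obtain ⟨x, hx, hxY⟩ := SetLike.exists_of_lt hY
  have h4 := h.sum_pow_eq hmax hmaxV x
  rw [Finset.sum_eq_single_of_mem i (Finset.mem_univ i), if_pos hx,
    ← Finset.add_sum_erase _ _ (Finset.mem_univ j), if_pos (hle hx), Nat.sub_self, pow_zero,
    show finrank K (V j) - finrank K (U i) = 1 by omega, pow_one] at h4
  · have h5 : Nat.card K ∣ ∑ k ∈ Finset.univ.erase j,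
        if x ∈ V k then Nat.card K ^ (finrank K (V j) - finrank K (V k)) else 0 := by
      refine Finset.dvd_sum fun k hk' => ?_
      split_ifs
      · refine dvd_pow_self _ ?_
        have := hk k (Finset.ne_of_mem_erase hk')
        have := hmaxV k
        omega
      · exact dvd_zero _
    have h6 := (Nat.dvd_add_left h5).mp (dvd_of_eq h4)
    have := Nat.le_of_dvd one_pos h6
    omega
  · intro k _ hki
    rw [if_neg]
    intro hxk
    exact hxY ⟨⟨hx, h3 i k l hki.symm ⟨⟨hx, hxk⟩, hle hx⟩⟩, hle hx⟩

open Module in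
theorem IsSolution.false_of_finrank_eq {K W : Type*} [Field K] [Finite K] [AddCommGroup W]
    [Module K W] {U U' V : Fin (Nat.card K + 1) → Submodule K W}
    [∀ i, FiniteDimensional K (V i)] [∀ i, FiniteDimensional K (U i)]
    [∀ i, FiniteDimensional K (U' i)] (h : IsSolution U V) (h' : IsSolution U' V)
    (hne : ∀ i j, U i ≠ V j) (hne' : ∀ i j, U' i ≠ V j) (hUU' : ∀ i j, U i ≠ U' j)
    {j a : Fin (Nat.card K + 1)} (hmax : ∀ i, finrank K (U i) ≤ finrank K (V j))
    (hmax' : ∀ i, finrank K (U' i) ≤ finrank K (V j))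
    (hmaxV : ∀ i, finrank K (V i) ≤ finrank K (V j)) (ha : finrank K (U a) = finrank K (V j)) :
    False := by
  by_cases hV : ∀ i, finrank K (V i) = finrank K (V j)
  · exact h.false_of_forall_finrank_eq h' hne hne' hUU'
      (h.finrank_eq_of_forall_finrank_eq hmax hV) (h'.finrank_eq_of_forall_finrank_eq hmax' hV) hV
  obtain ⟨i, hi⟩ : ∃ i, finrank K (U i) ≠ finrank K (V j) := by
    by_contra! hU
    exact hV (h.symm.finrank_eq_of_forall_finrank_eq hmaxV hU)
  obtain ⟨l, hl⟩ : ∃ i, finrank K (U' i) ≠ finrank K (V j) := by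
    by_contra! hU
    exact hV (h'.symm.finrank_eq_of_forall_finrank_eq hmaxV hU)
  obtain ⟨k, hkj, hk⟩ := h.exists_ne_finrank_eq (hne · j) hmax hmaxV hi
  -- As `U a` also has the largest dimension, `V` cuts a pencil out of it; equal entries would give
  -- a hyperplane where codimension two is required.
  have hVjk : V k ≠ V j := by
    intro e
    obtain ⟨h1, h2, -, -⟩ := h.symm.finrank_inf (j := a) (fun i => (hne a i).symm)
      (fun i => ha ▸ hmaxV i)
    have h3 := h1 j
    have h4 := h2 k j hkj
    rw [e, inf_idem] at h4
    omega
  have h1 := Submodule.finrank_lt_finrank_of_lt (lt_of_le_of_ne inf_le_right fun e =>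
    hVjk (Submodule.eq_of_le_of_finrank_eq (inf_eq_right.mp e) hk.symm).symm :
      V k ⊓ V j < V j)
  -- A smaller entry is a hyperplane of both `V j` and `V k`, so it is their intersection, whichever
  -- tuple it comes from.
  have key : ∀ {T : Fin (Nat.card K + 1) → Submodule K W} [∀ i, FiniteDimensional K (T i)]
      (_ : IsSolution T V) (_ : ∀ i j, T i ≠ V j) (_ : ∀ i, finrank K (T i) ≤ finrank K (V j))
      {i} (_ : finrank K (T i) ≠ finrank K (V j)), T i = V k ⊓ V j := by
    intro T _ hT hTV hm i hi
    obtain ⟨h2, h3⟩ := hT.le_of_finrank_ne (hTV · j) hm hi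
    obtain ⟨h4, -⟩ := hT.le_of_finrank_ne (hTV · k) (fun i => hk ▸ hm i) (hk ▸ hi)
    exact Submodule.eq_of_le_of_finrank_le (le_inf h4 h2) (by omega)
  exact hUU' i l ((key h hne hmax hi).trans (key h' hne' hmax' hl).symm)

open Module in
theorem IsSolution.false_of_finrank_le {K W : Type*} [Field K] [Finite K] [AddCommGroup W]
    [Module K W] {U U' V : Fin (Nat.card K + 1) → Submodule K W}
    [∀ i, FiniteDimensional K (V i)] [∀ i, FiniteDimensional K (U i)]
    [∀ i, FiniteDimensional K (U' i)] (h : IsSolution U V) (h' : IsSolution U' V)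
    (hne : ∀ i j, U i ≠ V j) (hne' : ∀ i j, U' i ≠ V j) (hUU' : ∀ i j, U i ≠ U' j)
    {j : Fin (Nat.card K + 1)} (hmax : ∀ i, finrank K (U i) ≤ finrank K (V j))
    (hmax' : ∀ i, finrank K (U' i) ≤ finrank K (V j))
    (hmaxV : ∀ i, finrank K (V i) ≤ finrank K (V j)) : False := by
  by_cases hU : ∃ a, finrank K (U a) = finrank K (V j)
  · obtain ⟨a, ha⟩ := hU
    exact h.false_of_finrank_eq h' hne hne' hUU' hmax hmax' hmaxV ha
  by_cases hU' : ∃ a, finrank K (U' a) = finrank K (V j)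
  · obtain ⟨a, ha⟩ := hU'
    exact h'.false_of_finrank_eq h hne' hne (fun i j => (hUU' j i).symm) hmax' hmax hmaxV ha
  push Not at hU hU'
  have h1 := fun i => h.le_of_finrank_ne (hne · j) hmax (hU i)
  have h1' := fun i => h'.le_of_finrank_ne (hne' · j) hmax' (hU' i)
  -- All entries of `U` and `U'` are now hyperplanes of `V j`, so common points of `U` are common to
  -- `U'` and the pencils coincide.
  obtain ⟨l, hl⟩ := h.exists_inf_eq_inf h' (hne · j) (hne' · j) hmax hmax'
    (fun x hx _ => (h.trans h'.symm).mem_of_forall_mem (n := finrank K (V j) - 1)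
      (fun i => by have := (h1 i).2; omega) (fun i => by have := (h1' i).2; omega) hx) j
  rw [inf_eq_left.mpr (h1 j).1, inf_eq_left.mpr (h1' l).1] at hl
  exact hUU' j l hl

theorem mainTheorem5 {K W : Type*} [Field K] [Finite K] [AddCommGroup W] [Module K W]
    (hW : 1 < Module.rank K W) (m : ℕ) (hm : m = Nat.card K + 1)
    (V U U' : Fin m → Submodule K W)
    (hV : ∀ i, FiniteDimensional K (V i)) (hU : ∀ i, FiniteDimensional K (U i))
    (hU' : ∀ i, FiniteDimensional K (U' i))
    (h : IsNontrivialSolution U V) (h' : IsNontrivialSolution U' V) :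
    TupleEquiv U U' := by
  subst hm
  by_contra hnot
  have hs : IsSolution U U' := h.1.trans h'.1.symm
  have hne := h.ne hV hU
  have hne' := h'.ne hV hU'
  have hUU' := IsNontrivialSolution.ne hU' hU ⟨hs, hnot⟩
  have hmax : ∀ T : Fin (Nat.card K + 1) → Submodule K W, ∃ j, ∀ i,
      Module.finrank K (T i) ≤ Module.finrank K (T j) :=
    fun T => Finite.exists_max fun i => Module.finrank K (T i)
  obtain ⟨a, ha⟩ := hmax V
  obtain ⟨b, hb⟩ := hmax U
  obtain ⟨c, hc⟩ := hmax U'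
  -- The three tuples play symmetric roles; one holding the largest dimension takes the place of
  -- `V`.
  rcases le_total (Module.finrank K (V a)) (Module.finrank K (U b)) with hab | hab
  · rcases le_total (Module.finrank K (U b)) (Module.finrank K (U' c)) with hbc | hbc
    · exact hs.false_of_finrank_le h'.1.symm hUU' (fun i j => (hne' j i).symm) hne
        (fun i => (hb i).trans hbc) (fun i => (ha i).trans (hab.trans hbc)) hc
    · exact h.1.symm.false_of_finrank_le hs.symm (fun i j => (hne j i).symm)
        (fun i j => (hUU' j i).symm) (fun i j => (hne' j i).symm)
        (fun i => (ha i).trans hab) (fun i => (hc i).trans hbc) hb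
  · rcases le_total (Module.finrank K (V a)) (Module.finrank K (U' c)) with hac | hac
    · exact hs.false_of_finrank_le h'.1.symm hUU' (fun i j => (hne' j i).symm) hne
        (fun i => (hb i).trans (hab.trans hac)) (fun i => (ha i).trans hac) hc
    · exact h.1.false_of_finrank_le h'.1 hne hne' hUU'
        (fun i => (hb i).trans hab) (fun i => (hc i).trans hac) ha
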